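/- For $\nu\in\mathbb C$ and $t\in\mathbb C\setminus\{0\}$ let $$J_\nu(t)=\Big(\frac t2\Big)^{\nu}\sum_{k=0}^{\infty}\frac{(-1)^k (t^2/4)^k}{k!\,\Gamma(\nu+k+1)}$$ be the Bessel function of the first kind (principal branch of the power, $\arg t\in(-\pi,\pi]$; $1/\Gamma$ is the entire reciprocal Gamma function), and let $$Y_\nu(t)=\frac{J_\nu(t)\cos(\nu\pi)-J_{-\nu}(t)}{\sin(\nu\pi)}$$ be the Bessel function of the second kind, the right-hand side being replaced by its limit when $\nu$ is an integer. Then for every integer $m\ge 0$ and every $t\in\mathbb C\setminus\{0\}$ the function $\nu\mapsto Y_\nu(t)$ is (complex) differentiable at $\nu=m$ and at $\nu=-m$, with $$\left.\frac{\partial Y_\nu(t)}{\partial\nu}\right|_{\nu=m}=-\frac{\pi}{2}J_m(t)+\frac{m!}{2}\sum_{k=0}^{m-1}\frac{Y_k(t)}{k!\,(m-k)}\Big(\frac t2\Big)^{k-m},$$ $$\left.\frac{\partial Y_\nu(t)}{\partial\nu}\right|_{\nu=-m}=(-1)^m\left[-\frac{\pi}{2}J_m(t)-\frac{m!}{2}\sum_{k=0}^{m-1}\frac{Y_k(t)}{k!\,(m-k)}\Big(\frac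 t2\Big)^{k-m}\right].$$ -/

import Mathlib

open Filter Topology
open scoped Nat

noncomputable section

/-- The Bessel function of the first kind `J_ν(t)` of complex order `ν`, for `t ≠ 0`, by its
ascending series
`J_ν(t) = (t/2)^ν ∑_{k ≥ 0} (-1)^k (t²/4)^k / (k! Γ(ν + k + 1))`.
The power `(t/2)^ν` is the principal one. At the poles of `Γ` Mathlib has `Γ = 0`, and division by
zero gives `0`, so that `1/Γ` is the entire reciprocal Gamma function. -/
def besselJ (ν t : ℂ) : ℂ :=
  (t / 2) ^ ν * ∑' k : ℕ, (-1) ^ k * (t ^ 2 / 4) ^ k / ((k ! : ℂ) * Complex.Gamma (ν + k + 1))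

/-- The quotient `(J_μ(t) cos(μπ) - J_{-μ}(t)) / sin(μπ)`, meaningful for non-integral `μ`. -/
def besselYQuotient (μ t : ℂ) : ℂ :=
  (besselJ μ t * Complex.cos (μ * Real.pi) - besselJ (-μ) t) / Complex.sin (μ * Real.pi)

open Classical in
/-- The Bessel function of the second kind `Y_ν(t)` of complex order `ν`, for `t ≠ 0`: for
non-integral `ν` it is `(J_ν(t) cos(νπ) - J_{-ν}(t)) / sin(νπ)`, and for integral `ν` it is the
limit of this quotient as the order tends to `ν`. -/
def besselY (ν t : ℂ) : ℂ :=
  if ∃ n : ℤ, ν = n then limUnder (𝓝[≠] ν) (fun μ : ℂ => besselYQuotient μ t)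
  else besselYQuotient ν t

end

/-- The convolution `∑ e_k / (m - k)` of a solution of a three-term recurrence satisfies the
inhomogeneous recurrence. -/
theorem sum_div_sub_recurrence (e : ℕ → ℂ) (y : ℂ)
    (he : ∀ k : ℕ, y * e k = (k + 1) * ((k + 1) * e (k + 1) - (k + 2) * e (k + 2))) (m : ℕ) :
    (m + 2 : ℂ) * ∑ k ∈ Finset.range (m + 2), e k / ((m + 2 : ℂ) - k) =
      (m + 1) * ∑ k ∈ Finset.range (m + 1), e k / ((m + 1 : ℂ) - k)
        - y / (m + 1) * ∑ k ∈ Finset.range m, e k / ((m : ℂ) - k) + 2 * e (m + 1) := by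
  have h1 : ∑ k ∈ Finset.range (m + 1), (k : ℂ) ^ 2 * e k / ((m + 1 : ℂ) - k) =
      ∑ k ∈ Finset.range m, ((k : ℂ) + 1) ^ 2 * e (k + 1) / ((m : ℂ) - k) := by
    rw [Finset.sum_range_succ']
    simp
  have h2 : ∑ k ∈ Finset.range (m + 2), ((k : ℂ) - 1) * k * e k / ((m + 2 : ℂ) - k) =
      ∑ k ∈ Finset.range m, ((k : ℂ) + 1) * (k + 2) * e (k + 2) / ((m : ℂ) - k) := by
    rw [Finset.sum_range_succ', Finset.sum_range_succ']
    simp only [Nat.cast_add, Nat.cast_one, Nat.cast_zero, mul_zero, zero_mul, zero_div, add_zero,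
      zero_add, sub_self]
    refine Finset.sum_congr rfl fun k _ => ?_
    congr 1 <;> ring
  have h3 : y * ∑ k ∈ Finset.range m, e k / ((m : ℂ) - k) =
      ∑ k ∈ Finset.range (m + 1), (k : ℂ) ^ 2 * e k / ((m + 1 : ℂ) - k) -
        ∑ k ∈ Finset.range (m + 2), ((k : ℂ) - 1) * k * e k / ((m + 2 : ℂ) - k) := by
    rw [h1, h2, Finset.mul_sum, ← Finset.sum_sub_distrib]
    refine Finset.sum_congr rfl fun k _ => ?_
    rw [← mul_div_assoc, he]
    ring
  have hm : (m + 1 : ℂ) ≠ 0 := Nat.cast_add_one_ne_zero m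
  rw [div_mul_eq_mul_div, h3, Finset.sum_range_succ _ (m + 1), Finset.sum_range_succ _ (m + 1)]
  have h4 : (m + 2 : ℂ) * ∑ k ∈ Finset.range (m + 1), e k / ((m + 2 : ℂ) - k) =
      (m + 1) * ∑ k ∈ Finset.range (m + 1), e k / ((m + 1 : ℂ) - k)
      - (∑ k ∈ Finset.range (m + 1), (k : ℂ) ^ 2 * e k / ((m + 1 : ℂ) - k) -
        ∑ k ∈ Finset.range (m + 1), ((k : ℂ) - 1) * k * e k / ((m + 2 : ℂ) - k)) / (m + 1) := by
    rw [Finset.mul_sum, Finset.mul_sum, ← Finset.sum_sub_distrib, Finset.sum_div,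
      ← Finset.sum_sub_distrib]
    refine Finset.sum_congr rfl fun k hk => ?_
    have hk : k < m + 1 := Finset.mem_range.1 hk
    have ha : (m + 1 : ℂ) - k ≠ 0 := sub_ne_zero.2 (by exact_mod_cast hk.ne')
    have hb : (m + 2 : ℂ) - k ≠ 0 := sub_ne_zero.2 (by exact_mod_cast (by omega : m + 2 ≠ k))
    field_simp
    ring
  rw [mul_add, h4]
  have hc : (m + 2 : ℂ) - (m + 1 : ℕ) = 1 := by push_cast; ring
  rw [hc]
  push_cast
  field_simp
  ring

theorem eq_factorial_mul_sum_of_recurrence (E D : ℕ → ℂ) {x : ℂ} (hx : x ≠ 0)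
    (hE : ∀ m : ℕ, E (m + 2) = (m + 1) / x * E (m + 1) - E m)
    (hD0 : D 0 = 0) (hD1 : D 1 = E 0 / x)
    (hD : ∀ m : ℕ, D (m + 2) = (m + 1) / x * D (m + 1) - D m + 2 / x * E (m + 1)) (m : ℕ) :
    D m = (m ! : ℂ) * ∑ k ∈ Finset.range m,
      E k / ((k ! : ℂ) * ((m : ℂ) - k)) * x ^ ((k : ℤ) - (m : ℤ)) := by
  have hf : ∀ k : ℕ, (k ! : ℂ) ≠ 0 := fun k => by exact_mod_cast k.factorial_ne_zero
  have hs : ∀ k : ℕ, (k + 1 : ℂ) ≠ 0 := Nat.cast_add_one_ne_zero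
  have hs2 : ∀ k : ℕ, (k + 2 : ℂ) ≠ 0 := fun k => by exact_mod_cast (by omega : k + 2 ≠ 0)
  set e : ℕ → ℂ := fun k => E k * x ^ k / k ! with he
  have key : ∀ m : ℕ, D m * x ^ m / m ! = ∑ k ∈ Finset.range m, e k / ((m : ℂ) - k) := by
    have hrec := sum_div_sub_recurrence e (x ^ 2) fun k => by
      simp only [he, hE, Nat.factorial_succ, Nat.cast_mul, Nat.cast_add, Nat.cast_one]
      have := hf k; have := hs k; have := hs2 k
      have h2 : (k : ℂ) + 1 + 1 ≠ 0 := by exact_mod_cast (by omega : k + 1 + 1 ≠ 0)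
      field_simp
      ring
    intro m
    induction m using Nat.twoStepInduction with
    | zero => simp [hD0]
    | one => simp [hD1, he, hx]
    | more m ih1 ih2 =>
      have h := hrec m
      push_cast at ih1 ih2 ⊢
      rw [← ih1, ← ih2] at h
      refine mul_left_cancel₀ (hs2 m) ?_
      rw [h, hD]
      simp only [he, Nat.factorial_succ, Nat.cast_mul, Nat.cast_add, Nat.cast_one]
      have := hf m; have := hs m; have := hs2 m
      have h2 : (m : ℂ) + 1 + 1 ≠ 0 := by exact_mod_cast (by omega : m + 1 + 1 ≠ 0)
      field_simp
      ring
  have hk := key m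
  rw [div_eq_iff (hf m)] at hk
  rw [← mul_right_inj' (pow_ne_zero m hx), mul_comm, hk, mul_comm, mul_left_comm]
  congr 1
  rw [Finset.mul_sum]
  refine Finset.sum_congr rfl fun k hk => ?_
  have ha : (m : ℂ) - k ≠ 0 := sub_ne_zero.2 (by exact_mod_cast (Finset.mem_range.1 hk).ne')
  have := hf k
  rw [zpow_sub₀ hx, zpow_natCast, zpow_natCast]
  simp only [he]
  field_simp

/-- The reciprocal Gamma function is bounded on every disc, uniformly in shifts to the right. -/
theorem exists_norm_inv_Gamma_add_nat_le (R : ℝ) :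
    ∃ C : ℝ, ∀ k : ℕ, ∀ ν ∈ Metric.ball (0 : ℂ) R, ‖(Complex.Gamma (ν + k + 1))⁻¹‖ ≤ C := by
  have hb : ∀ k : ℕ, ∃ C : ℝ, ∀ ν ∈ Metric.ball (0 : ℂ) R,
      ‖(Complex.Gamma (ν + k + 1))⁻¹‖ ≤ C := fun k => by
    have hc : Continuous fun ν : ℂ => (Complex.Gamma (ν + k + 1))⁻¹ :=
      Complex.differentiable_one_div_Gamma.continuous.comp
        (by fun_prop : Continuous fun ν : ℂ => ν + k + 1)
    obtain ⟨C, hC⟩ := (isCompact_closedBall (0 : ℂ) R).exists_bound_of_continuousOn hc.continuousOn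
    exact ⟨C, fun ν hν => hC ν (Metric.ball_subset_closedBall hν)⟩
  choose C hC using hb
  obtain ⟨N, hN⟩ := exists_nat_ge R
  refine ⟨∑ k ∈ Finset.range (N + 1), |C k|, fun k ν hν => ?_⟩
  have hle : ∀ j ∈ Finset.range (N + 1), |C j| ≤ ∑ k ∈ Finset.range (N + 1), |C k| :=
    fun j hj => Finset.single_le_sum (f := fun k => |C k|) (fun _ _ => abs_nonneg _) hj
  rcases le_total k N with hk | hk
  · exact (hC k ν hν).trans ((le_abs_self _).trans (hle k (Finset.mem_range.2 (by omega))))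
  · induction k, hk using Nat.le_induction with
    | base => exact (hC N ν hν).trans ((le_abs_self _).trans (hle N (Finset.mem_range.2 (by omega))))
    | succ k hk ih =>
      refine le_trans ?_ ih
      rw [Complex.one_div_Gamma_eq_self_mul_one_div_Gamma_add_one (ν + k + 1), norm_mul]
      push_cast
      rw [← add_assoc ν]
      refine le_mul_of_one_le_left (norm_nonneg _) ?_
      have h1 : (k + 1 : ℝ) ≤ ‖ν + k + 1‖ + ‖ν‖ := by
        have := norm_sub_le (ν + k + 1) ν
        rw [show ν + k + 1 - ν = ((k + 1 : ℕ) : ℂ) by push_cast; ring, Complex.norm_natCast] at this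
        exact_mod_cast this
      have h2 : ‖ν‖ < R := by simpa using hν
      have h3 : (N : ℝ) ≤ k := by exact_mod_cast hk
      linarith

theorem besselJ_term_eq (ν t : ℂ) (k : ℕ) :
    (-1) ^ k * (t ^ 2 / 4) ^ k / ((k ! : ℂ) * Complex.Gamma (ν + k + 1)) =
      (-(t ^ 2 / 4)) ^ k / k ! * (Complex.Gamma (ν + k + 1))⁻¹ := by
  rw [neg_pow (t ^ 2 / 4), div_mul_eq_div_div, div_eq_mul_inv _ (Complex.Gamma _)]

theorem exists_summable_bound (z : ℂ) (R : ℝ) :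
    ∃ u : ℕ → ℝ, Summable u ∧ ∀ k : ℕ, ∀ ν ∈ Metric.ball (0 : ℂ) R,
      ‖z ^ k / k ! * (Complex.Gamma (ν + k + 1))⁻¹‖ ≤ u k := by
  obtain ⟨C, hC⟩ := exists_norm_inv_Gamma_add_nat_le R
  refine ⟨fun k => ‖z‖ ^ k / k ! * C, (Real.summable_pow_div_factorial ‖z‖).mul_right C,
    fun k ν hν => ?_⟩
  rw [norm_mul, norm_div, norm_pow, Complex.norm_natCast]
  exact mul_le_mul_of_nonneg_left (hC k ν hν) (by positivity)

theorem summable_pow_div_factorial_mul_inv_Gamma (z ν : ℂ) :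
    Summable fun k : ℕ => z ^ k / k ! * (Complex.Gamma (ν + k + 1))⁻¹ := by
  obtain ⟨u, hu, h⟩ := exists_summable_bound z (‖ν‖ + 1)
  exact .of_norm_bounded hu fun k => h k ν (by simp)

theorem differentiable_tsum_inv_Gamma (z : ℂ) :
    Differentiable ℂ fun ν : ℂ => ∑' k : ℕ, z ^ k / k ! * (Complex.Gamma (ν + k + 1))⁻¹ := by
  intro ν
  obtain ⟨u, hu, h⟩ := exists_summable_bound z (‖ν‖ + 1)
  refine (Complex.differentiableOn_tsum_of_summable_norm hu (fun k => ?_) Metric.isOpen_ball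
    h).differentiableAt (Metric.isOpen_ball.mem_nhds (by simp))
  exact ((Complex.differentiable_one_div_Gamma.comp
    (by fun_prop : Differentiable ℂ fun ν : ℂ => ν + k + 1)).const_mul _).differentiableOn

theorem besselJ_eq (ν t : ℂ) : besselJ ν t = (t / 2) ^ ν *
    ∑' k : ℕ, (-(t ^ 2 / 4)) ^ k / k ! * (Complex.Gamma (ν + k + 1))⁻¹ := by
  simp only [besselJ, besselJ_term_eq]

theorem differentiable_besselJ {t : ℂ} (ht : t ≠ 0) : Differentiable ℂ fun ν => besselJ ν t := by
  simp only [besselJ_eq]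
  refine Differentiable.mul (fun ν => ?_) (differentiable_tsum_inv_Gamma _)
  exact differentiableAt_id.const_cpow (Or.inl (by simpa using ht))

theorem tsum_inv_Gamma_recurrence (z ν : ℂ) :
    ∑' k : ℕ, z ^ k / k ! * (Complex.Gamma (ν - 1 + k + 1))⁻¹
      - z * ∑' k : ℕ, z ^ k / k ! * (Complex.Gamma (ν + 1 + k + 1))⁻¹ =
      ν * ∑' k : ℕ, z ^ k / k ! * (Complex.Gamma (ν + k + 1))⁻¹ := by
  have hs := summable_pow_div_factorial_mul_inv_Gamma z
  have hterm : ∀ k : ℕ, z ^ k / k ! * (Complex.Gamma (ν - 1 + k + 1))⁻¹ -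
      ν * (z ^ k / k ! * (Complex.Gamma (ν + k + 1))⁻¹) =
      k * (z ^ k / k ! * (Complex.Gamma (ν + k + 1))⁻¹) := fun k => by
    have := Complex.one_div_Gamma_eq_self_mul_one_div_Gamma_add_one (ν + k)
    rw [show ν - 1 + k + 1 = ν + k by ring, this]
    ring
  have hsum : Summable fun k : ℕ => k * (z ^ k / k ! * (Complex.Gamma (ν + k + 1))⁻¹) := by
    simpa only [hterm] using (hs (ν - 1)).sub ((hs ν).mul_left ν)
  rw [sub_eq_iff_eq_add', ← sub_eq_iff_eq_add, ← tsum_mul_left, ← tsum_mul_left,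
    ← (hs (ν - 1)).tsum_sub ((hs ν).mul_left ν)]
  simp only [hterm]
  rw [hsum.tsum_eq_zero_add]
  simp only [Nat.cast_zero, zero_mul, zero_add]
  refine tsum_congr fun k => ?_
  have hf : (k ! : ℂ) ≠ 0 := by exact_mod_cast k.factorial_ne_zero
  have hk : (k + 1 : ℂ) ≠ 0 := Nat.cast_add_one_ne_zero k
  rw [Nat.factorial_succ]
  push_cast
  rw [show ν + 1 + k + 1 = ν + (k + 1) + 1 by ring, pow_succ]
  field_simp

theorem besselJ_recurrence {t : ℂ} (ht : t ≠ 0) (ν : ℂ) :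
    besselJ (ν - 1) t + besselJ (ν + 1) t = ν / (t / 2) * besselJ ν t := by
  have hx : t / 2 ≠ 0 := by simpa using ht
  have h := tsum_inv_Gamma_recurrence (-(t ^ 2 / 4)) ν
  simp only [besselJ_eq]
  rw [Complex.cpow_sub _ _ hx, Complex.cpow_add _ _ hx, Complex.cpow_one]
  calc _ = (t / 2) ^ ν / (t / 2) *
        (∑' k : ℕ, (-(t ^ 2 / 4)) ^ k / k ! * (Complex.Gamma (ν - 1 + k + 1))⁻¹
      - (-(t ^ 2 / 4)) *
        ∑' k : ℕ, (-(t ^ 2 / 4)) ^ k / k ! * (Complex.Gamma (ν + 1 + k + 1))⁻¹) := by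
        field_simp
        ring
    _ = _ := by rw [h]; ring

/-- A removable quotient `g / s` at a simple zero of `s`, with its value and derivative there. -/
theorem exists_removable_quotient {g s : ℂ → ℂ} (hg : Differentiable ℂ g) (hs : Differentiable ℂ s)
    {a : ℂ} (hga : g a = 0) (hsa : s a = 0) (hs' : deriv s a ≠ 0) :
    ∃ h : ℂ → ℂ, (∀ᶠ z in 𝓝[≠] a, h z = g z / s z) ∧ h a = deriv g a / deriv s a ∧
      HasDerivAt h ((deriv (deriv g) a - h a * deriv (deriv s) a) / (2 * deriv s a)) a := by
  have hdg : Differentiable ℂ (dslope g a) := differentiableOn_univ.1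
    ((Complex.differentiableOn_dslope univ_mem).2 hg.differentiableOn)
  have hds : Differentiable ℂ (dslope s a) := differentiableOn_univ.1
    ((Complex.differentiableOn_dslope univ_mem).2 hs.differentiableOn)
  have hne : dslope s a a ≠ 0 := by rwa [dslope_same]
  have key : ∀ f : ℂ → ℂ, Differentiable ℂ f → Differentiable ℂ (dslope f a) → f a = 0 →
      deriv (deriv f) a = 2 * deriv (dslope f a) a := fun f hf hd hfa => by
    have h0 : f = fun z => (z - a) * dslope f a z := by
      ext z
      have := sub_smul_dslope f a z
      rw [smul_eq_mul, hfa, sub_zero] at this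
      exact this.symm
    have h1 : deriv f = fun z => dslope f a z + (z - a) * deriv (dslope f a) z := by
      ext z
      have := (((hasDerivAt_id z).sub_const a).mul (hd z).hasDerivAt).deriv
      conv_lhs => rw [h0]
      refine Eq.trans this ?_
      simp
    have h2 := ((hd a).hasDerivAt.add (((hasDerivAt_id a).sub_const a).mul
      (hd.deriv a).hasDerivAt)).deriv
    rw [h1]
    refine Eq.trans h2 ?_
    simp
    ring
  refine ⟨fun z => dslope g a z / dslope s a z, ?_, by simp [dslope_same], ?_⟩
  · filter_upwards [self_mem_nhdsWithin] with z hz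
    have hz' : z - a ≠ 0 := sub_ne_zero.2 hz
    rw [dslope_of_ne _ hz, dslope_of_ne _ hz, slope_def_field, slope_def_field, hga, hsa, sub_zero,
      sub_zero, div_div_div_cancel_right₀ hz']
  · refine ((hdg a).hasDerivAt.div (hds a).hasDerivAt hne).congr_deriv ?_
    rw [key g hg hdg hga, key s hs hds hsa, ← dslope_same s a]
    field_simp

theorem eventually_nhdsNE_int_ne (n : ℤ) : ∀ᶠ z : ℂ in 𝓝[≠] (n : ℂ), ¬ ∃ k : ℤ, z = k := by
  rw [eventually_nhdsWithin_iff]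
  filter_upwards [Metric.ball_mem_nhds (n : ℂ) one_pos] with z hz hzn
  rintro ⟨k, rfl⟩
  rw [Metric.mem_ball, dist_eq_norm, ← Int.cast_sub, Complex.norm_intCast] at hz
  have : |k - n| < 1 := by exact_mod_cast hz
  exact hzn (by rw [Set.mem_singleton_iff, sub_eq_zero.1 (Int.abs_lt_one_iff.1 this)])

theorem besselY_eq_and_hasDerivAt_int {t : ℂ} (hJ : Differentiable ℂ fun ν => besselJ ν t) (n : ℤ)
    (hn : besselJ (-(n : ℂ)) t = (-1) ^ n * besselJ n t) :
    let f := fun ν => besselJ ν t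
    besselY n t = (deriv f n + (-1) ^ n * deriv f (-n)) / Real.pi ∧
    HasDerivAt (fun ν => besselY ν t)
      ((deriv (deriv f) n - (-1) ^ n * deriv (deriv f) (-n)) / (2 * Real.pi)
        - Real.pi / 2 * f n) n := by
  intro f
  have hf : Differentiable ℂ f := hJ
  have hpi : (Real.pi : ℂ) ≠ 0 := by exact_mod_cast Real.pi_ne_zero
  have hcn : Complex.cos (n * Real.pi) = (-1) ^ n := by
    simpa using congrArg ((↑) : ℝ → ℂ) (Real.cos_int_mul_pi n)
  have hsn : Complex.sin (n * Real.pi) = 0 := by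
    rw [← Complex.ofReal_intCast, ← Complex.ofReal_mul, ← Complex.ofReal_sin, Real.sin_int_mul_pi,
      Complex.ofReal_zero]
  have hsq : ((-1 : ℂ) ^ n) * (-1) ^ n = 1 := by
    rw [← mul_zpow]; simp
  have hlin : ∀ z : ℂ, HasDerivAt (fun z : ℂ => z * Real.pi) Real.pi z := fun z => by
    simpa using (hasDerivAt_id z).mul_const (Real.pi : ℂ)
  have hneg : ∀ (F : ℂ → ℂ), Differentiable ℂ F → ∀ z, HasDerivAt (fun z => F (-z))
      (-deriv F (-z)) z := fun F hF z => by
    exact ((hF (-z)).hasDerivAt.comp z (hasDerivAt_neg z)).congr_deriv (by ring)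
  set s : ℂ → ℂ := fun z => Complex.sin (z * Real.pi) with hs
  set g : ℂ → ℂ := fun z => f z * Complex.cos (z * Real.pi) - f (-z) with hg
  have hs1 : ∀ z, HasDerivAt s (Complex.cos (z * Real.pi) * Real.pi) z := fun z => (hlin z).csin
  have hc1 : ∀ z, HasDerivAt (fun z : ℂ => Complex.cos (z * Real.pi))
    (-Complex.sin (z * Real.pi) * Real.pi) z := fun z => (hlin z).ccos
  have hs1' : deriv s = fun z => Complex.cos (z * Real.pi) * Real.pi :=
    funext fun z => (hs1 z).deriv
  have hs2 : deriv (deriv s) n = 0 := by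
    rw [hs1', ((hc1 n).mul_const (Real.pi : ℂ)).deriv, hsn]; ring
  have hg1 : ∀ z, HasDerivAt g (deriv f z * Complex.cos (z * Real.pi) +
      f z * (-Complex.sin (z * Real.pi) * Real.pi) - -deriv f (-z)) z := fun z =>
    ((hf z).hasDerivAt.mul (hc1 z)).sub (hneg f hf z)
  have hg1' : deriv g = fun z => deriv f z * Complex.cos (z * Real.pi) +
      f z * (-Complex.sin (z * Real.pi) * Real.pi) - -deriv f (-z) := funext fun z => (hg1 z).deriv
  have hg2 : deriv (deriv g) n = (-1) ^ n * deriv (deriv f) n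
      - Real.pi ^ 2 * (-1) ^ n * f n - deriv (deriv f) (-n) := by
    rw [hg1']
    have := ((((hf.deriv n).hasDerivAt.mul (hc1 n)).add ((hf n).hasDerivAt.mul
      ((hs1 n).neg.mul_const (Real.pi : ℂ)))).sub (hneg _ hf.deriv n).neg).deriv
    refine Eq.trans this ?_
    simp only [hs, hcn, hsn, Pi.neg_apply]
    ring
  have hgn : g n = 0 := by simp only [hg, hcn, f, hn]; ring
  have hs'n : deriv s n ≠ 0 := by
    rw [hs1']; simp only [hcn]; exact mul_ne_zero (left_ne_zero_of_mul_eq_one hsq) hpi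
  obtain ⟨h, hev, hn0, hd⟩ := exists_removable_quotient (fun z => (hg1 z).differentiableAt)
    (fun z => (hs1 z).differentiableAt) hgn hsn hs'n
  have hlim : besselY n t = h n := by
    rw [besselY, if_pos ⟨n, rfl⟩]
    refine Tendsto.limUnder_eq ?_
    refine (hd.continuousAt.tendsto.mono_left nhdsWithin_le_nhds).congr' ?_
    filter_upwards [hev] with z hz
    exact hz
  have hY : (fun ν => besselY ν t) =ᶠ[𝓝 (n : ℂ)] h := by
    have : ∀ᶠ z in 𝓝[≠] (n : ℂ), besselY z t = h z := by
      filter_upwards [hev, eventually_nhdsNE_int_ne n] with z hz hzn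
      rw [besselY, if_neg hzn, hz]
      rfl
    rw [eventually_nhdsWithin_iff] at this
    filter_upwards [this] with z hz
    by_cases hzn : z = n
    · rw [hzn]; exact hlim
    · exact hz hzn
  have hε : ((-1 : ℂ) ^ n) ≠ 0 := left_ne_zero_of_mul_eq_one hsq
  constructor
  · rw [hlim, hn0, hg1', hs1']
    simp only [hcn, hsn]
    rw [div_eq_div_iff (mul_ne_zero hε hpi) hpi]
    linear_combination (-deriv f (-n) * Real.pi) * hsq
  · refine (hd.congr_of_eventuallyEq hY).congr_deriv ?_
    rw [hs2, hg2, hs1']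
    simp only [hcn]
    rw [div_eq_iff (mul_ne_zero two_ne_zero (mul_ne_zero hε hpi))]
    field_simp
    linear_combination (deriv (deriv f) (-n)) * hsq

theorem deriv_recurrence {F G : ℂ → ℂ} (hF : Differentiable ℂ F) (hG : Differentiable ℂ G) {x : ℂ}
    (h : ∀ ν, F (ν - 1) + F (ν + 1) = ν / x * F ν + G ν / x) (ν : ℂ) :
    deriv F (ν - 1) + deriv F (ν + 1) = ν / x * deriv F ν + (F ν + deriv G ν) / x := by
  have h1 := ((hF (ν - 1)).hasDerivAt.comp_sub_const ν 1).add
    ((hF (ν + 1)).hasDerivAt.comp_add_const ν 1)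
  have h2 := (((hasDerivAt_id ν).div_const x).mul (hF ν).hasDerivAt).add
    ((hG ν).hasDerivAt.div_const x)
  have h3 := h1.unique (h2.congr_of_eventuallyEq (Eventually.of_forall h))
  rw [h3]
  simp only [id]
  ring

theorem apply_neg_natCast_of_recurrence {f : ℂ → ℂ} {x : ℂ}
    (h : ∀ ν, f (ν - 1) + f (ν + 1) = ν / x * f ν) (m : ℕ) : f (-m) = (-1) ^ m * f m := by
  induction m using Nat.twoStepInduction with
  | zero => simp
  | one =>
    have := h 0
    simp only [zero_sub, zero_add, zero_div, zero_mul] at this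
    simpa using eq_neg_of_add_eq_zero_left this
  | more m ih1 ih2 =>
    have h1 := h (m + 1)
    have h2 := h (-(m + 1))
    push_cast at ih2 ⊢
    rw [show (m + 1 : ℂ) - 1 = m by ring, show (m + 1 : ℂ) + 1 = m + 2 by ring] at h1
    rw [show -(m + 1 : ℂ) - 1 = -(m + 2) by ring, show -(m + 1 : ℂ) + 1 = -m by ring] at h2
    rw [ih1, ih2] at h2
    linear_combination h2 - (-1) ^ m * h1

/-- The second derivatives at `m` and `-m` of a solution of the Bessel recurrence in terms of first
derivatives. -/
theorem deriv_deriv_sub_eq_sum {f : ℂ → ℂ} (hf : Differentiable ℂ f) {x : ℂ} (hx : x ≠ 0)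
    (h : ∀ ν, f (ν - 1) + f (ν + 1) = ν / x * f ν) (m : ℕ) :
    deriv (deriv f) m - (-1) ^ m * deriv (deriv f) (-m) = (m ! : ℂ) * ∑ k ∈ Finset.range m,
      (deriv f k + (-1) ^ k * deriv f (-k)) / ((k ! : ℂ) * ((m : ℂ) - k)) *
        x ^ ((k : ℤ) - (m : ℤ)) := by
  have hd1 : ∀ ν, deriv f (ν - 1) + deriv f (ν + 1) = ν / x * deriv f ν + f ν / x := fun ν => by
    simpa using deriv_recurrence hf (differentiable_const (0 : ℂ)) (x := x) (by simpa using h) ν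
  have hd2 := deriv_recurrence hf.deriv hf hd1
  have a1 : ∀ k : ℕ, (k + 1 : ℂ) - 1 = k := fun k => by ring
  have a2 : ∀ k : ℕ, (k + 1 : ℂ) + 1 = k + 2 := fun k => by ring
  have a3 : ∀ k : ℕ, -(k + 1 : ℂ) - 1 = -(k + 2) := fun k => by ring
  have a4 : ∀ k : ℕ, -(k + 1 : ℂ) + 1 = -k := fun k => by ring
  refine eq_factorial_mul_sum_of_recurrence (fun k => deriv f k + (-1) ^ k * deriv f (-k))
    (fun k => deriv (deriv f) k - (-1) ^ k * deriv (deriv f) (-k)) hx (fun k => ?_) (by simp) ?_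
    (fun k => ?_) m
  · have h1 := hd1 (k + 1)
    have h2 := hd1 (-(k + 1))
    have h3 := apply_neg_natCast_of_recurrence h (k + 1)
    have hsq : ((-1 : ℂ) ^ k) * (-1) ^ k = 1 := by rw [← mul_pow]; simp
    rw [a1, a2] at h1
    rw [a3, a4] at h2
    push_cast at h3 ⊢
    rw [h3] at h2
    linear_combination h1 + (-1) ^ k * h2 - f (k + 1) / x * hsq
  · have := hd2 0
    simp only [zero_sub, zero_add, zero_div, zero_mul] at this
    simp only [Nat.cast_one, Nat.cast_zero, neg_zero, pow_zero, pow_one, one_mul]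
    linear_combination this
  · have h1 := hd2 (k + 1)
    have h2 := hd2 (-(k + 1))
    rw [a1, a2] at h1
    rw [a3, a4] at h2
    push_cast
    linear_combination h1 - (-1) ^ k * h2

theorem mainTheorem9 (m : ℕ) (t : ℂ) (ht : t ≠ 0) :
    HasDerivAt (fun ν : ℂ => besselY ν t)
      (-(Real.pi / 2) * besselJ m t
        + (m ! : ℂ) / 2 * ∑ k ∈ Finset.range m,
            besselY k t / ((k ! : ℂ) * ((m : ℂ) - (k : ℂ))) * (t / 2) ^ ((k : ℤ) - (m : ℤ)))
      (m : ℂ) ∧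
    HasDerivAt (fun ν : ℂ => besselY ν t)
      ((-1) ^ m * (-(Real.pi / 2) * besselJ m t
        - (m ! : ℂ) / 2 * ∑ k ∈ Finset.range m,
            besselY k t / ((k ! : ℂ) * ((m : ℂ) - (k : ℂ))) * (t / 2) ^ ((k : ℤ) - (m : ℤ))))
      (-(m : ℂ)) := by
  have hJ := differentiable_besselJ ht
  have hx : t / 2 ≠ 0 := by simpa using ht
  have hrec := besselJ_recurrence ht
  have hsym : ∀ k : ℕ, besselJ (-(k : ℂ)) t = (-1) ^ k * besselJ k t :=
    apply_neg_natCast_of_recurrence (f := fun ν => besselJ ν t) hrec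
  have hsq : ((-1 : ℂ) ^ m) * (-1) ^ m = 1 := by rw [← mul_pow]; simp
  have hY : ∀ k : ℕ, besselY k t = (deriv (fun ν => besselJ ν t) k +
      (-1) ^ k * deriv (fun ν => besselJ ν t) (-k)) / Real.pi := fun k => by
    simpa using (besselY_eq_and_hasDerivAt_int hJ k (by simpa using hsym k)).1
  have hD := deriv_deriv_sub_eq_sum hJ hx hrec m
  have hS : (m ! : ℂ) / 2 * ∑ k ∈ Finset.range m,
      besselY k t / ((k ! : ℂ) * ((m : ℂ) - (k : ℂ))) * (t / 2) ^ ((k : ℤ) - (m : ℤ)) =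
      (deriv (deriv fun ν => besselJ ν t) m -
        (-1) ^ m * deriv (deriv fun ν => besselJ ν t) (-m)) / (2 * Real.pi) := by
    rw [hD, mul_div_mul_comm, Finset.sum_div]
    congr 1
    refine Finset.sum_congr rfl fun k _ => ?_
    rw [hY]
    ring
  rw [hS]
  constructor
  · have h1 := (besselY_eq_and_hasDerivAt_int hJ m (by simpa using hsym m)).2
    simp only [Int.cast_natCast, zpow_natCast] at h1
    exact h1.congr_deriv (by ring)
  · have h1 := (besselY_eq_and_hasDerivAt_int hJ (-m) (by
      simp only [Int.cast_neg, Int.cast_natCast, neg_neg, hsym, zpow_neg, zpow_natCast]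
      rw [inv_mul_cancel_left₀ (left_ne_zero_of_mul_eq_one hsq)])).2
    simp only [Int.cast_neg, Int.cast_natCast, neg_neg, zpow_neg, zpow_natCast, hsym,
      inv_eq_of_mul_eq_one_left hsq] at h1
    refine h1.congr_deriv ?_
    linear_combination (-deriv (deriv fun ν => besselJ ν t) (-m) / (2 * Real.pi)) * hsq
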